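/- **Conventions.** Let $t_0\in\mathbb R$, let $\mathcal D\subseteq\mathbb R^n$ be open and connected with $0\in\mathcal D$, and let $\Omega=\mathcal D\times[t_0,\infty)$. Let $F:\mathbb R^n\times[t_0,\infty)\rightrightarrows\mathbb R^n$ be a set-valued map. A *solution* of $\dot x\in F(x,t)$ on a right-open interval $[s,T)$, $t_0\le s<T\le\infty$, is a locally absolutely continuous $x:[s,T)\to\mathbb R^n$ with $\dot x(t)\in F(x(t),t)$ for almost every $t$; it is *complete* if $T=\infty$ and *maximal* if it has no proper right extension that is a solution. $F$ *admits solutions over $\Omega$* if for every $(y,\tau)\in\Omega$ there is a solution on some $[\tau,T)$ with $x(\tau)=y$. A function $W:\mathcal D\to\mathbb R$ is *positive definite* if $W(0)=0$ and $W(x)>0$ for $x\in\mathcal D\setminus\{0\}$; $V:\Omega\to\mathbb R$ is positive definite if $V(0,t)=0$ for all $t\ge t_0$ and $V(x,t)\ge W_0(x)$ on $\Omega$ for some continuous positive definite $W_0:\mathcal D\to\mathbb R$. For a locally Lipschitz $U:\Omega\to\mathbb R$, $\partial U(x,t)\subset\mathbb R^{n+1}$ is the *Clarke gradient*: the closed convex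 hull of all limits $\lim\nabla U(x_i,t_i)$ with $(x_i,t_i)\to(x,t)$, where the $(x_i,t_i)$ are interior points of $\Omega$ at which $U$ is differentiable. $U$ is *regular* if at each interior point $z$ of $\Omega$ and for each $v$ the one-sided derivative $\lim_{h\downarrow0}(U(z+hv)-U(z))/h$ exists and equals $\limsup_{y\to z,\,h\downarrow0}(U(y+hv)-U(y))/h$. Let $\mathcal U=\{U_i\}_{i=1}^\infty$ be locally Lipschitz regular functions on $\Omega$, and put $$\tilde F_{\mathcal U}(x,t)=\bigcap_{i}\{q\in F(x,t)\mid \exists a\in\mathbb R,\ p^T[q;1]=a\ \ \forall p\in\partial U_i(x,t)\}.$$ The *$\mathcal U$-generalized derivative* of a locally Lipschitz $V:\Omega\to\mathbb R$ is $$\dot{\overline V}_{\mathcal U}(x,t)=\min_{p\in\partial V(x,t)}\ \max_{q\in\tilde F_{\mathcal U}(x,t)}p^T[q;1]\ \text{ if } V \text{ is regular},\qquad \dot{\overline V}_{\mathcal U}(x,t)=\max_{p\in\partial V(x,t)}\ \max_{q\in\tilde F_{\mathcal U}(x,t)}p^T[q;1]\ \text{ otherwise},$$ understood as $-\infty$ where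 $\tilde F_{\mathcal U}(x,t)=\emptyset$. With $\overline{\mathrm B}(0,r)$ the closed ball, the inclusion is *uniformly stable* at $x=0$ if for every $\epsilon>0$ there is $\delta>0$ such that, for every $s\ge t_0$, every maximal solution $x$ starting at time $s$ with $x(s)\in\overline{\mathrm B}(0,\delta)$ is complete and stays in $\overline{\mathrm B}(0,\epsilon)$. For $c>0$ consider the property $A(c)$: for every $\epsilon>0$ there is $\tau\ge0$ such that, for every $s\ge t_0$, every maximal solution $x$ starting at time $s$ with $x(s)\in\overline{\mathrm B}(0,c)$ is complete and $x(t)\in\overline{\mathrm B}(0,\epsilon)$ for all $t\ge s+\tau$. The inclusion is *uniformly asymptotically stable* at $x=0$ if it is uniformly stable and $A(c)$ holds for some $c>0$, and *globally uniformly asymptotically stable* if it is uniformly stable and $A(c)$ holds for every $c>0$. **Theorem.** Let $F$ be locally bounded on $\mathbb R^n\times[t_0,\infty)$ with compact values, and suppose that it admits solutions over $\Omega$. Let $V:\Omega\to\mathbb R$ be locally Lipschitz and positive definite, let $\mathcal U$ be as above, and let $\underline W,\overline W:\mathcal D\to\mathbb R$ be continuous and positive definite. Suppose that $\underline W(x)\le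 V(x,t)\le\overline W(x)$ for all $(x,t)\in\Omega$, and that for almost every $t\ge t_0$ one has $\dot{\overline V}_{\mathcal U}(x,t)\le0$ for all $x\in\mathcal D$. Then: 1. $\dot x\in F(x,t)$ is uniformly stable at $x=0$. 2. If in addition there is a continuous positive definite $W:\mathcal D\to\mathbb R$ such that for almost every $t\ge t_0$ one has $\dot{\overline V}_{\mathcal U}(x,t)\le-W(x)$ for all $x\in\mathcal D$, then $\dot x\in F(x,t)$ is uniformly asymptotically stable at $x=0$. 3. If, furthermore, $\mathcal D=\mathbb R^n$ and $\{x\in\mathbb R^n\mid\underline W(x)\le c\}$ is compact for every $c\ge0$, then $\dot x\in F(x,t)$ is globally uniformly asymptotically stable at $x=0$. -/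

import Mathlib

open Set Filter Topology MeasureTheory

namespace DiffInclusion

noncomputable section

/-! ### Solutions of a differential inclusion `ẋ ∈ F (x, t)` -/

section Solutions

variable {E : Type*} [NormedAddCommGroup E] [NormedSpace ℝ E]

/-- The right-open interval `[s, T)` of the real line, `T ∈ (s, ∞]`. -/
def timeInterval (s : ℝ) (T : EReal) : Set ℝ :=
  {t : ℝ | s ≤ t ∧ (t : EReal) < T}

/-- `x` is a solution of `ẋ ∈ F (x, t)` over `[s, T)`: the interval has nonzero length, `x` is
locally absolutely continuous on it, and `ẋ(t)` exists and belongs to `F (x(t), t)` for almost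
every `t` in it. The values of `x` outside `[s, T)` are irrelevant. -/
structure IsSolution (F : E → ℝ → Set E) (x : ℝ → E) (s : ℝ) (T : EReal) : Prop where
  lt : (s : EReal) < T
  absolutelyContinuous : ∀ b ∈ timeInterval s T, AbsolutelyContinuousOnInterval x s b
  deriv_mem : ∀ᵐ t ∂volume.restrict (timeInterval s T), ∃ v ∈ F (x t) t, HasDerivAt x v t

/-- A solution over `[s, T)` is maximal if no solution over some `[s, T')` with `T' > T`
extends it. -/
def IsMaximalSolution (F : E → ℝ → Set E) (x : ℝ → E) (s : ℝ) (T : EReal) : Prop :=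
  IsSolution F x s T ∧
    ¬ ∃ (T' : EReal) (y : ℝ → E), T < T' ∧ IsSolution F y s T' ∧ EqOn x y (timeInterval s T)

/-- `F` admits (local) solutions over `D × J`. -/
def AdmitsSolutions (F : E → ℝ → Set E) (D : Set E) (J : Set ℝ) : Prop :=
  ∀ y ∈ D, ∀ τ ∈ J, ∃ (T : EReal) (x : ℝ → E), IsSolution F x τ T ∧ x τ = y

/-- Local boundedness of a set-valued map on `E × [t₀, ∞)`: every point has a neighborhood over
which the union of the values is bounded. -/
def IsLocallyBounded (F : E → ℝ → Set E) (t₀ : ℝ) : Prop :=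
  ∀ x : E, ∀ t ∈ Ici t₀, ∃ N ∈ 𝓝 (x, t),
    Bornology.IsBounded (⋃ z ∈ N ∩ univ ×ˢ Ici t₀, F z.1 z.2)

/-! ### Stability at the origin, uniformly in the initial time `s ≥ t₀`

A maximal solution over `[s, T)` is complete when `T = ∞`. -/

/-- Uniform stability at the origin. -/
def UniformlyStable (F : E → ℝ → Set E) (t₀ : ℝ) : Prop :=
  ∀ ε : ℝ, 0 < ε → ∃ δ : ℝ, 0 < δ ∧
    ∀ (s : ℝ) (T : EReal) (x : ℝ → E), t₀ ≤ s → IsMaximalSolution F x s T →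
      x s ∈ Metric.closedBall 0 δ → T = ⊤ ∧ ∀ t, s ≤ t → x t ∈ Metric.closedBall 0 ε

/-- Every maximal solution that starts in the closed ball of radius `c` is complete, and these
solutions converge to the origin uniformly in the initial time and the initial state. -/
def UniformlyAttracts (F : E → ℝ → Set E) (t₀ c : ℝ) : Prop :=
  ∀ ε : ℝ, 0 < ε → ∃ τ : ℝ, 0 ≤ τ ∧
    ∀ (s : ℝ) (T : EReal) (x : ℝ → E), t₀ ≤ s → IsMaximalSolution F x s T →
      x s ∈ Metric.closedBall 0 c → T = ⊤ ∧ ∀ t, s + τ ≤ t → x t ∈ Metric.closedBall 0 ε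

/-- Uniform asymptotic stability at the origin. -/
def UniformlyAsymptoticallyStable (F : E → ℝ → Set E) (t₀ : ℝ) : Prop :=
  UniformlyStable F t₀ ∧ ∃ c : ℝ, 0 < c ∧ UniformlyAttracts F t₀ c

/-- Global uniform asymptotic stability at the origin. -/
def GloballyUniformlyAsymptoticallyStable (F : E → ℝ → Set E) (t₀ : ℝ) : Prop :=
  UniformlyStable F t₀ ∧ ∀ c : ℝ, 0 < c → UniformlyAttracts F t₀ c

end Solutions

/-! ### Clarke's calculus -/

section Clarke

variable {X : Type*} [NormedAddCommGroup X] [NormedSpace ℝ X]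

/-- The Clarke gradient at `z` of a locally Lipschitz function `f` on `Ω`: the closed convex hull
of the limits of gradients `∇f(zᵢ)` along sequences `zᵢ → z` in the interior of `Ω` at which `f`
is differentiable. Gradients are identified with the linear forms that they represent, so `pᵀ w`
is written `p w`. -/
def clarkeGradient (Ω : Set X) (f : X → ℝ) (z : X) : Set (X →L[ℝ] ℝ) :=
  closedConvexHull ℝ
    {p | ∃ w : ℕ → X, (∀ i, w i ∈ interior Ω ∧ DifferentiableAt ℝ f (w i)) ∧
      Tendsto w atTop (𝓝 z) ∧ Tendsto (fun i => fderiv ℝ f (w i)) atTop (𝓝 p)}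

/-- Clarke's generalized directional derivative
`f°(z; v) = limsup_{y → z, h ↓ 0} (f (y + h v) - f y) / h`. -/
def clarkeDirDeriv (f : X → ℝ) (z v : X) : ℝ :=
  limsup (fun yh : X × ℝ => (f (yh.1 + yh.2 • v) - f yh.1) / yh.2) (𝓝 z ×ˢ 𝓝[>] (0 : ℝ))

/-- Clarke regularity at a point (of a function that is Lipschitz near the point): for every
direction, the one-sided directional derivative exists and equals the generalized one. -/
def ClarkeRegularAt (f : X → ℝ) (z : X) : Prop :=
  ∀ v : X, Tendsto (fun h : ℝ => (f (z + h • v) - f z) / h) (𝓝[>] 0) (𝓝 (clarkeDirDeriv f z v))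

/-- Regularity of a locally Lipschitz function on `Ω`, tested at the interior points of `Ω`, where
two-sided neighborhoods are available. -/
def ClarkeRegularOn (Ω : Set X) (f : X → ℝ) : Prop :=
  ∀ z ∈ interior Ω, ClarkeRegularAt f z

end Clarke

/-! ### Reduced inclusions and generalized derivatives -/

section Reduction

variable {E : Type*} [NormedAddCommGroup E] [NormedSpace ℝ E]

/-- The reduction `G_U^H` of a set-valued map `H` by a function `U` on `Ω`: the directions
`q ∈ H (x, t)` for which `pᵀ[q; 1]` does not depend on `p ∈ ∂U (x, t)`. -/
def reduction (Ω : Set (E × ℝ)) (U : E × ℝ → ℝ) (H : E → ℝ → Set E) (x : E) (t : ℝ) : Set E :=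
  {q ∈ H x t | ∃ a : ℝ, ∀ p ∈ clarkeGradient Ω U (x, t), p (q, 1) = a}

/-- The reduced inclusion of a sequence of functions: the intersection of the reductions. -/
def reducedInclusion (Ω : Set (E × ℝ)) (U : ℕ → E × ℝ → ℝ) (F : E → ℝ → Set E)
    (x : E) (t : ℝ) : Set E :=
  ⋂ i, reduction Ω (U i) F x t

open Classical in
/-- The `𝒰`-generalized derivative of `V` in the directions `F`, an extended real number: a min-max
over `∂V (x, t)` and the reduced inclusion if `V` is regular on `Ω`, and a max-max if it is not.
The extrema are written as infima and suprema; the supremum over the empty set is `-∞`. -/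
def generalizedDeriv (Ω : Set (E × ℝ)) (U : ℕ → E × ℝ → ℝ) (F : E → ℝ → Set E)
    (V : E × ℝ → ℝ) (x : E) (t : ℝ) : EReal :=
  if ClarkeRegularOn Ω V then
    ⨅ p ∈ clarkeGradient Ω V (x, t), ⨆ q ∈ reducedInclusion Ω U F x t, ((p (q, 1) : ℝ) : EReal)
  else
    ⨆ p ∈ clarkeGradient Ω V (x, t), ⨆ q ∈ reducedInclusion Ω U F x t, ((p (q, 1) : ℝ) : EReal)

/-- `W` is positive definite on `D`. -/
def PositiveDefiniteOn (D : Set E) (W : E → ℝ) : Prop :=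
  W 0 = 0 ∧ ∀ x ∈ D, x ≠ 0 → 0 < W x

/-- `V` is positive definite on `D × [t₀, ∞)`: it vanishes at `x = 0` and is bounded below,
uniformly in time, by a continuous positive definite function of the state. -/
def TimeVaryingPositiveDefiniteOn (D : Set E) (t₀ : ℝ) (V : E × ℝ → ℝ) : Prop :=
  (∀ t ∈ Ici t₀, V (0, t) = 0) ∧
    ∃ W₀ : E → ℝ, ContinuousOn W₀ D ∧ PositiveDefiniteOn D W₀ ∧
      ∀ x ∈ D, ∀ t ∈ Ici t₀, W₀ x ≤ V (x, t)

end Reduction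

end

end DiffInclusion

open DiffInclusion

/-! ### Absolutely continuous curves -/

/-! Along a solution `x`, the curve `t ↦ (x t, t)` is absolutely continuous, and so are its
compositions with the locally Lipschitz functions `V` and `U i` while `x` stays in `D`. Hence at
almost every time `x`, `V (x t, t)` and all the `U i (x t, t)` are differentiable together. At such
a time let `q` be the velocity. A Lipschitz function has the same derivative along the curve as
along the line in direction `(q, 1)`, and a regular function differentiable along a line has Clarke
gradients that all agree on its direction. Applied to the `U i`, this puts `q` in the reduced
inclusion; applied to `V`, it bounds the derivative of `V (x t, t)` by the generalized derivative
(`le_generalizedDeriv`). For `V` not regular, Rademacher's theorem and compactness supply one Clarke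
gradient that is large enough.

Integration gives `DecreasesAlongSolutions`, and nonsmooth analysis ends there. The rest is
Lyapunov's argument: a sphere that solutions cannot reach gives stability, a strict rate of decrease
gives attraction, and confinement to a compact set gives completeness because local boundedness of
`F` makes a solution Lipschitz up to a finite end time. -/

theorem LipschitzOnWith.comp_absolutelyContinuousOnInterval {X Y : Type*}
    [PseudoMetricSpace X] [PseudoMetricSpace Y] {K : NNReal} {S : Set X} {f : X → Y} {g : ℝ → X}
    {a b : ℝ} (hf : LipschitzOnWith K f S) (hg : AbsolutelyContinuousOnInterval g a b)
    (hgS : MapsTo g (uIcc a b) S) : AbsolutelyContinuousOnInterval (f ∘ g) a b := by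
  rw [absolutelyContinuousOnInterval_iff] at hg ⊢
  intro ε hε
  obtain ⟨δ, hδ, h⟩ := hg (ε / (K + 1)) (by positivity)
  refine ⟨δ, hδ, fun I hI hlen => ?_⟩
  have h' := h I hI hlen
  calc ∑ i ∈ Finset.range I.1, dist ((f ∘ g) (I.2 i).1) ((f ∘ g) (I.2 i).2)
      ≤ ∑ i ∈ Finset.range I.1, (K + 1) * dist (g (I.2 i).1) (g (I.2 i).2) := by
        refine Finset.sum_le_sum fun i hi => ?_
        have hmem := hI.1 i hi
        refine (hf.dist_le_mul _ (hgS hmem.1) _ (hgS hmem.2)).trans ?_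
        gcongr
        simp
    _ = (K + 1) * ∑ i ∈ Finset.range I.1, dist (g (I.2 i).1) (g (I.2 i).2) := by
        rw [Finset.mul_sum]
    _ < (K + 1) * (ε / (K + 1)) := by gcongr
    _ = ε := by field_simp

theorem AbsolutelyContinuousOnInterval.prodMk_id {X : Type*} [PseudoMetricSpace X] {g : ℝ → X}
    {a b : ℝ} (hg : AbsolutelyContinuousOnInterval g a b) :
    AbsolutelyContinuousOnInterval (fun t => (g t, t)) a b := by
  rw [absolutelyContinuousOnInterval_iff] at hg ⊢
  intro ε hε
  obtain ⟨δ, hδ, h⟩ := hg (ε / 2) (by positivity)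
  refine ⟨min δ (ε / 2), by positivity, fun I hI hlen => ?_⟩
  have h' := h I hI (hlen.trans_le (min_le_left _ _))
  have h'' := hlen.trans_le (min_le_right _ _)
  calc ∑ i ∈ Finset.range I.1, dist (g (I.2 i).1, (I.2 i).1) (g (I.2 i).2, (I.2 i).2)
      ≤ ∑ i ∈ Finset.range I.1, (dist (g (I.2 i).1) (g (I.2 i).2) + dist (I.2 i).1 (I.2 i).2) := by
        refine Finset.sum_le_sum fun i hi => ?_
        rw [Prod.dist_eq]
        exact max_le_add_of_nonneg dist_nonneg dist_nonneg
    _ < ε := by rw [Finset.sum_add_distrib]; linarith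

/-- Extending an absolutely continuous curve by constants keeps it absolutely continuous. -/
theorem AbsolutelyContinuousOnInterval.comp_clamp {X : Type*} [PseudoMetricSpace X] {g : ℝ → X}
    {a b : ℝ} (hab : a ≤ b) (hg : AbsolutelyContinuousOnInterval g a b) (c d : ℝ) :
    AbsolutelyContinuousOnInterval (fun t => g (max a (min b t))) c d := by
  have hd : ∀ p q : ℝ, dist (max a (min b p)) (max a (min b q)) ≤ dist p q := fun p q => by
    rw [Real.dist_eq, Real.dist_eq, abs_le]
    constructor <;> cases abs_cases (p - q) <;> grind
  -- Clamping only shrinks intervals, so disjoint families stay disjoint.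
  have hsub : ∀ p q : ℝ, uIoc (max a (min b p)) (max a (min b q)) ⊆ uIoc p q := by
    intro p q t ht
    rw [mem_uIoc] at ht ⊢
    simp only [max_lt_iff, min_lt_iff, le_max_iff, le_min_iff] at ht
    grind
  rw [absolutelyContinuousOnInterval_iff] at hg ⊢
  intro ε hε
  obtain ⟨δ, hδ, h⟩ := hg ε hε
  refine ⟨δ, hδ, fun I hI hlen => ?_⟩
  refine h (I.1, fun i => (max a (min b (I.2 i).1), max a (min b (I.2 i).2))) ⟨?_, ?_⟩ ?_
  · intro i _
    rw [uIcc_of_le hab]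
    exact ⟨⟨le_max_left _ _, max_le hab (min_le_left _ _)⟩,
      ⟨le_max_left _ _, max_le hab (min_le_left _ _)⟩⟩
  · intro i hi j hj hij
    exact (hI.2 hi hj hij).mono (hsub _ _) (hsub _ _)
  · exact (Finset.sum_le_sum fun i _ => hd _ _).trans_lt hlen

/-- Two absolutely continuous curves that agree at the junction can be concatenated. -/
theorem AbsolutelyContinuousOnInterval.concat {X : Type*} [NormedAddCommGroup X] [NormedSpace ℝ X]
    {f g y : ℝ → X} {a b c : ℝ} (hab : a ≤ b) (hbc : b ≤ c)
    (hf : AbsolutelyContinuousOnInterval f a b) (hg : AbsolutelyContinuousOnInterval g b c)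
    (hyf : ∀ t ∈ Icc a b, y t = f t) (hyg : ∀ t ∈ Icc b c, y t = g t) :
    AbsolutelyContinuousOnInterval y a c := by
  -- On `[a, c]` the concatenation is `f` frozen after `b`, plus `g` frozen before `b`, minus the
  -- common value `g b`.
  have hconst : AbsolutelyContinuousOnInterval (fun _ : ℝ => -g b) a c :=
    (LipschitzWith.const (-g b)).lipschitzOnWith.absolutelyContinuousOnInterval
  have hsum := ((hf.comp_clamp hab a c).add (hg.comp_clamp hbc a c)).add hconst
  have hb : f b = g b := (hyf b ⟨hab, le_rfl⟩).symm.trans (hyg b ⟨le_rfl, hbc⟩)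
  have heq : ∀ t ∈ uIcc a c, y t = f (max a (min b t)) + g (max b (min c t)) + -g b := by
    intro t ht
    rw [uIcc_of_le (hab.trans hbc)] at ht
    rcases le_total t b with h | h
    · rw [hyf t ⟨ht.1, h⟩, min_eq_right h, max_eq_right ht.1, min_eq_right ht.2, max_eq_left h]
      abel
    · rw [hyg t ⟨h, ht.2⟩, min_eq_left h, max_eq_right hab, min_eq_right ht.2, max_eq_right h, hb]
      abel
  rw [absolutelyContinuousOnInterval_iff] at hsum ⊢
  intro ε hε
  obtain ⟨δ, hδ, h⟩ := hsum ε hε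
  refine ⟨δ, hδ, fun I hI hlen => lt_of_eq_of_lt (Finset.sum_congr rfl fun i hi => ?_)
    (h I hI hlen)⟩
  rw [heq _ (hI.1 i hi).1, heq _ (hI.1 i hi).2]
  rfl

theorem AbsolutelyContinuousOnInterval.sub_le_of_ae_deriv_le {f : ℝ → ℝ} {a b c : ℝ} (hab : a ≤ b)
    (hf : AbsolutelyContinuousOnInterval f a b) (h : ∀ᵐ t, t ∈ Ioo a b → deriv f t ≤ c) :
    f b - f a ≤ c * (b - a) := by
  rw [← hf.integral_deriv_eq_sub]
  calc ∫ t in a..b, deriv f t ≤ ∫ _ in a..b, c := by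
        refine intervalIntegral.integral_mono_ae_restrict hab hf.intervalIntegrable_deriv (by simp) ?_
        rw [Filter.EventuallyLE, Measure.restrict_congr_set Ioo_ae_eq_Icc.symm,
          ae_restrict_iff' measurableSet_Ioo]
        exact h
    _ = c * (b - a) := by simp [mul_comm]

/-- A norming functional of the increment reduces this to the scalar case. -/
theorem AbsolutelyContinuousOnInterval.norm_sub_le_of_ae_norm_deriv_le {X : Type*}
    [NormedAddCommGroup X] [NormedSpace ℝ X] {f : ℝ → X} {a b M : ℝ} (hab : a ≤ b)
    (hf : AbsolutelyContinuousOnInterval f a b)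
    (h : ∀ᵐ t, t ∈ Ioo a b → ∃ v, ‖v‖ ≤ M ∧ HasDerivAt f v t) :
    ‖f b - f a‖ ≤ M * (b - a) := by
  obtain ⟨g, hg, hgx⟩ := exists_dual_vector'' ℝ (f b - f a)
  have hac : AbsolutelyContinuousOnInterval (g ∘ f) a b :=
    (g.lipschitz.lipschitzOnWith (s := univ)).comp_absolutelyContinuousOnInterval hf
      (mapsTo_univ _ _)
  have := hac.sub_le_of_ae_deriv_le hab (c := M) (by
    filter_upwards [h] with t ht hmem
    obtain ⟨v, hv, hd⟩ := ht hmem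
    rw [(g.hasFDerivAt.comp_hasDerivAt t hd).deriv]
    calc g v ≤ ‖g v‖ := le_abs_self _
      _ ≤ ‖g‖ * ‖v‖ := g.le_opNorm v
      _ ≤ 1 * M := by gcongr
      _ = M := one_mul M)
  simpa [← map_sub, hgx] using this

/-! ### Clarke's calculus along a direction -/

section Clarke

theorem LocallyLipschitzOn.exists_isOpen_lipschitzOnWith {X : Type*}
    [NormedAddCommGroup X] {f : X → ℝ} {Ω : Set X}
    (hf : LocallyLipschitzOn Ω f) {z : X} (hz : z ∈ interior Ω) :
    ∃ (K : NNReal) (S : Set X), IsOpen S ∧ z ∈ S ∧ S ⊆ Ω ∧ LipschitzOnWith K f S := by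
  obtain ⟨K, t, ht, hK⟩ := hf (interior_subset hz)
  rw [nhdsWithin_eq_nhds.2 (mem_interior_iff_mem_nhds.1 hz)] at ht
  exact ⟨K, interior t ∩ interior Ω, isOpen_interior.inter isOpen_interior,
    ⟨mem_interior_iff_mem_nhds.2 ht, hz⟩, fun _ h => interior_subset h.2,
    hK.mono fun _ h => interior_subset h.1⟩

variable {X : Type*} [NormedAddCommGroup X] [NormedSpace ℝ X]

/-- A Lipschitz function has the same derivative along a curve and along its tangent. -/
theorem LipschitzOnWith.hasDerivAt_along_tangent {f : X → ℝ} {K : NNReal} {S : Set X} {c : ℝ → X}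
    {t a : ℝ} {v : X} (hf : LipschitzOnWith K f S) (hS : S ∈ 𝓝 (c t)) (hc : HasDerivAt c v t)
    (hfc : HasDerivAt (f ∘ c) a t) : HasDerivAt (fun h : ℝ => f (c t + h • v)) a 0 := by
  have hfc' := (hasDerivAt_iff_isLittleO_nhds_zero).1 hfc
  have hc' := (hasDerivAt_iff_isLittleO_nhds_zero).1 hc
  rw [hasDerivAt_iff_isLittleO_nhds_zero]
  have h1 : Tendsto (fun h : ℝ => c (t + h)) (𝓝 0) (𝓝 (c t)) := by
    have : ContinuousAt (fun h : ℝ => c (t + h)) 0 :=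
      ContinuousAt.comp (by simpa using hc.continuousAt) (by fun_prop)
    simpa [ContinuousAt] using this
  have h2 : Tendsto (fun h : ℝ => c t + h • v) (𝓝 0) (𝓝 (c t)) := by
    have : ContinuousAt (fun h : ℝ => c t + h • v) 0 := by fun_prop
    simpa [ContinuousAt] using this
  -- The curve and its tangent are `o(h)` apart, and the Lipschitz bound transfers this to `f`.
  have hO : (fun h : ℝ => f (c t + h • v) - f (c (t + h))) =O[𝓝 0]
      (fun h : ℝ => c (t + h) - c t - h • v) := by
    refine Asymptotics.IsBigO.of_bound K ?_
    filter_upwards [h1.eventually hS, h2.eventually hS] with h m1 m2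
    refine (hf.norm_sub_le m2 m1).trans_eq ?_
    rw [show c t + h • v - c (t + h) = -(c (t + h) - c t - h • v) by abel, norm_neg]
  refine ((hO.trans_isLittleO hc').add hfc').congr_left fun h => ?_
  simp
  ring

/-- The real-valued `limsup` in `clarkeDirDeriv` controls the quotients only when they are
eventually bounded above. -/
theorem LipschitzOnWith.isBoundedUnder_clarke_quotient {f : X → ℝ} {K : NNReal} {S : Set X} {z : X}
    (hf : LipschitzOnWith K f S) (hS : S ∈ 𝓝 z) (v : X) :
    IsBoundedUnder (· ≤ ·) (𝓝 z ×ˢ 𝓝[>] (0 : ℝ))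
      (fun yh : X × ℝ => (f (yh.1 + yh.2 • v) - f yh.1) / yh.2) := by
  refine ⟨K * ‖v‖, ?_⟩
  rw [eventually_map]
  have h2 : Tendsto (fun yh : X × ℝ => yh.1 + yh.2 • v) (𝓝 z ×ˢ 𝓝[>] (0 : ℝ)) (𝓝 z) := by
    have : ContinuousAt (fun yh : X × ℝ => yh.1 + yh.2 • v) (z, 0) := by fun_prop
    have h3 : Tendsto (fun yh : X × ℝ => yh.1 + yh.2 • v) (𝓝 z ×ˢ 𝓝 (0 : ℝ)) (𝓝 z) := by
      rw [← nhds_prod_eq]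
      simpa [ContinuousAt] using this
    exact h3.mono_left (Filter.prod_mono_right _ nhdsWithin_le_nhds)
  have h0 : ∀ᶠ yh : X × ℝ in 𝓝 z ×ˢ 𝓝[>] (0 : ℝ), 0 < yh.2 :=
    tendsto_snd.eventually self_mem_nhdsWithin
  filter_upwards [h2.eventually hS, tendsto_fst.eventually hS, h0] with yh m1 m2 hpos
  rw [div_le_iff₀ hpos]
  refine (le_abs_self _).trans ((hf.norm_sub_le m1 m2).trans (le_of_eq ?_))
  rw [add_sub_cancel_left, norm_smul, Real.norm_of_nonneg hpos.le]
  ring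

theorem HasDerivAt.tendsto_right_quotient {f : X → ℝ} {z v : X} {a : ℝ}
    (h : HasDerivAt (fun s : ℝ => f (z + s • v)) a 0) :
    Tendsto (fun s : ℝ => (f (z + s • v) - f z) / s) (𝓝[>] 0) (𝓝 a) := by
  have := h.tendsto_slope_zero_right
  refine this.congr fun s => ?_
  simp [div_eq_inv_mul]

theorem DifferentiableAt.hasDerivAt_along {f : X → ℝ} {z : X} (h : DifferentiableAt ℝ f z) (v : X) :
    HasDerivAt (fun s : ℝ => f (z + s • v)) (fderiv ℝ f z v) 0 :=
  h.hasFDerivAt.hasLineDerivAt v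

/-- The Clarke gradient is dominated by the generalized directional derivative. -/
theorem apply_le_clarkeDirDeriv_of_mem_clarkeGradient {f : X → ℝ} {K : NNReal} {S Ω : Set X} {z : X}
    (hf : LipschitzOnWith K f S) (hS : S ∈ 𝓝 z) {p : X →L[ℝ] ℝ}
    (hp : p ∈ clarkeGradient Ω f z) (v : X) : p v ≤ clarkeDirDeriv f z v := by
  -- The bound cuts out a closed half-space, so it need only be checked on limits of gradients.
  have hconv : Convex ℝ {p : X →L[ℝ] ℝ | p v ≤ clarkeDirDeriv f z v} :=
    convex_halfSpace_le (f := fun p : X →L[ℝ] ℝ => p v) ⟨fun _ _ => rfl, fun _ _ => rfl⟩ _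
  have hclosed : IsClosed {p : X →L[ℝ] ℝ | p v ≤ clarkeDirDeriv f z v} :=
    isClosed_le (by fun_prop) continuous_const
  refine closedConvexHull_min ?_ hconv hclosed hp
  rintro p ⟨w, hw, hwz, hwp⟩
  change p v ≤ clarkeDirDeriv f z v
  refine le_of_forall_gt_imp_ge_of_dense fun b hb => ?_
  have hev := eventually_lt_of_limsup_lt hb (hf.isBoundedUnder_clarke_quotient hS v)
  have hlim : Tendsto (fun i => fderiv ℝ f (w i) v) atTop (𝓝 (p v)) :=
    ((ContinuousLinearMap.apply ℝ ℝ v).continuous.tendsto p).comp hwp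
  refine le_of_tendsto hlim ?_
  filter_upwards [hwz.eventually hev.curry] with i hi
  refine le_of_tendsto ((hw i).2.hasDerivAt_along v).tendsto_right_quotient ?_
  filter_upwards [hi] with h hh using hh.le

/-- If a regular function is differentiable along a line, then all its Clarke gradients take the
same value on the direction of the line. -/
theorem DiffInclusion.ClarkeRegularAt.apply_eq_of_mem_clarkeGradient {f : X → ℝ} {K : NNReal} {S Ω : Set X}
    {z v : X} {a : ℝ} (hreg : ClarkeRegularAt f z) (hf : LipschitzOnWith K f S) (hS : S ∈ 𝓝 z)
    (ha : HasDerivAt (fun s : ℝ => f (z + s • v)) a 0) {p : X →L[ℝ] ℝ}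
    (hp : p ∈ clarkeGradient Ω f z) : p v = a := by
  have key : ∀ (u : X) (b : ℝ), HasDerivAt (fun s : ℝ => f (z + s • u)) b 0 → p u ≤ b := by
    intro u b hb
    rw [tendsto_nhds_unique hb.tendsto_right_quotient (hreg u)]
    exact apply_le_clarkeDirDeriv_of_mem_clarkeGradient hf hS hp u
  refine le_antisymm (key v a ha) ?_
  -- The derivative is two-sided, so `key` in direction `-v` gives the reverse inequality.
  have hneg : HasDerivAt (fun s : ℝ => f (z + s • -v)) (-a) 0 := by
    have h0 : HasDerivAt (fun s : ℝ => f (z + s • v)) a (-0) := by simpa using ha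
    have := h0.scomp (0 : ℝ) (hasDerivAt_neg (0 : ℝ))
    simpa [Function.comp_def] using this
  have := key _ _ hneg
  rw [map_neg] at this
  linarith

variable [FiniteDimensional ℝ X]

/-- A bound on the directional derivative at the points of differentiability of a Lipschitz function
bounds its increments. -/
theorem LipschitzWith.sub_le_of_fderiv_le {g : X → ℝ} {K : NNReal} (hg : LipschitzWith K g)
    {z v : X} {r c h : ℝ} (hh : 0 ≤ h) (hr : h * ‖v‖ < r)
    (hc : ∀ w ∈ Metric.ball z r, DifferentiableAt ℝ g w → fderiv ℝ g w v ≤ c) :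
    g (z + h • v) - g z ≤ c * h := by
  let _ : MeasurableSpace X := borel X
  have : BorelSpace X := ⟨rfl⟩
  have hmeas : MeasurableSet {w | DifferentiableAt ℝ g w} := measurableSet_of_differentiableAt ℝ g
  -- Rademacher and Fubini: almost every line parallel to `v` meets the non-differentiability set in
  -- a null set. Such lines are dense, and the inequality is closed in the base point.
  have hae : ∀ᵐ y ∂(Measure.addHaar : Measure X), ∀ᵐ s ∂(volume : Measure ℝ),
      y + (LinearMap.toSpanSingleton ℝ X v) s ∈ {w | DifferentiableAt ℝ g w} :=
    (ae_ae_add_linearMap_mem_iff _ _ _ hmeas).2 hg.ae_differentiableAt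
  have hdense := Measure.dense_of_ae hae
  have hclosed : IsClosed {y | g (y + h • v) - g y ≤ c * h} :=
    isClosed_le (by have := hg.continuous; fun_prop) continuous_const
  -- Base points within `r - h * ‖v‖` of `z` keep the whole segment in the ball of radius `r`.
  have hpos : 0 < r - h * ‖v‖ := by linarith
  refine hclosed.closure_subset_iff.2 ?_
    (hdense.open_subset_closure_inter Metric.isOpen_ball (Metric.mem_ball_self hpos))
  rintro y ⟨hy, hyA⟩
  have hlip : LipschitzWith (K * ‖v‖₊) (fun s : ℝ => g (y + s • v)) := by
    refine hg.comp (LipschitzWith.of_dist_le_mul fun s t => ?_)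
    rw [dist_add_left, dist_eq_norm, ← sub_smul, norm_smul, mul_comm, dist_eq_norm]
    rfl
  have hac : AbsolutelyContinuousOnInterval (fun s : ℝ => g (y + s • v)) 0 h :=
    hlip.lipschitzOnWith.absolutelyContinuousOnInterval
  have := hac.sub_le_of_ae_deriv_le hh (c := c) (by
    filter_upwards [hyA] with s hs hmem
    have hs' : DifferentiableAt ℝ g (y + s • v) := hs
    have hder : HasDerivAt (fun s : ℝ => g (y + s • v)) (fderiv ℝ g (y + s • v) v) s := by
      have h1 : HasDerivAt (fun s : ℝ => y + s • v) v s := by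
        simpa using ((hasDerivAt_id s).smul_const v).const_add y
      exact hs'.hasFDerivAt.comp_hasDerivAt s h1
    rw [hder.deriv]
    refine hc _ ?_ hs'
    rw [Metric.mem_ball, dist_eq_norm] at hy ⊢
    calc ‖y + s • v - z‖ = ‖(y - z) + s • v‖ := by congr 1; abel
      _ ≤ ‖y - z‖ + s * ‖v‖ := by
          refine (norm_add_le _ _).trans_eq ?_
          rw [norm_smul, Real.norm_of_nonneg hmem.1.le]
      _ ≤ ‖y - z‖ + h * ‖v‖ := by gcongr; exact hmem.2.le
      _ < r := by linarith)
  simpa using this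

/-- Otherwise `fderiv ℝ f w v ≤ b` at every nearby point of differentiability; integrating along
segments bounds the difference quotients at `z` by `b < a`. -/
theorem LipschitzOnWith.exists_differentiableAt_lt_fderiv {f : X → ℝ} {K : NNReal} {S : Set X}
    {z v : X} {a b r : ℝ} (hf : LipschitzOnWith K f S) (hS : IsOpen S) (hz : z ∈ S)
    (ha : HasDerivAt (fun s : ℝ => f (z + s • v)) a 0) (hb : b < a) (hr : 0 < r) :
    ∃ w ∈ Metric.ball z r ∩ S, DifferentiableAt ℝ f w ∧ b < fderiv ℝ f w v := by
  by_contra! hcon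
  obtain ⟨g, hg, hfg⟩ := hf.extend_real
  obtain ⟨r₁, hr₁, hball⟩ := Metric.isOpen_iff.1 (Metric.isOpen_ball.inter hS) z
    ⟨Metric.mem_ball_self hr, hz⟩
  have hev : ∀ w ∈ S, f =ᶠ[𝓝 w] g := fun w hw => hfg.eventuallyEq_of_mem (hS.mem_nhds hw)
  have hga : HasDerivAt (fun s : ℝ => g (z + s • v)) a 0 := by
    refine ha.congr_of_eventuallyEq ?_
    have h2 : Tendsto (fun h : ℝ => z + h • v) (𝓝 0) (𝓝 z) := by
      have : ContinuousAt (fun h : ℝ => z + h • v) 0 := by fun_prop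
      simpa [ContinuousAt] using this
    exact (h2.eventually (hev z hz)).mono fun _ h => h.symm
  have hsmall : ∀ᶠ h : ℝ in 𝓝[>] 0, h * ‖v‖ < r₁ := by
    have : Tendsto (fun h : ℝ => h * ‖v‖) (𝓝 0) (𝓝 0) := by
      simpa using (tendsto_id (α := ℝ) (x := 𝓝 0)).mul_const ‖v‖
    exact (this.mono_left nhdsWithin_le_nhds).eventually (gt_mem_nhds hr₁)
  refine hb.not_ge (le_of_tendsto hga.tendsto_right_quotient ?_)
  filter_upwards [hsmall, self_mem_nhdsWithin] with h h1 (h2 : 0 < h)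
  rw [div_le_iff₀ h2]
  refine hg.sub_le_of_fderiv_le h2.le h1 fun w hw hd => ?_
  have hwS := hball hw
  rw [← (hev w hwS.2).fderiv_eq]
  exact hcon w hwS ((hev w hwS.2).differentiableAt_iff.2 hd)

/-- If a locally Lipschitz function is differentiable along a line, some Clarke gradient is at least
its derivative on the direction of the line. -/
theorem exists_mem_clarkeGradient_le_apply {f : X → ℝ} {K : NNReal} {S Ω : Set X} {z v : X} {a : ℝ}
    (hf : LipschitzOnWith K f S) (hS : IsOpen S) (hz : z ∈ S) (hSΩ : S ⊆ Ω)
    (ha : HasDerivAt (fun s : ℝ => f (z + s • v)) a 0) :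
    ∃ p ∈ clarkeGradient Ω f z, a ≤ p v := by
  choose w hw hd hlt using fun i : ℕ =>
    hf.exists_differentiableAt_lt_fderiv hS hz ha
      (sub_lt_self a (Nat.one_div_pos_of_nat (α := ℝ) (n := i)))
      (Nat.one_div_pos_of_nat (α := ℝ) (n := i))
  have : ProperSpace (X →L[ℝ] ℝ) := FiniteDimensional.proper ℝ _
  -- The gradients have norm at most `K`, so a subsequence converges.
  obtain ⟨p, -, φ, hφ, hp⟩ := (isCompact_closedBall (0 : X →L[ℝ] ℝ) K).tendsto_subseq
    (x := fun i => fderiv ℝ f (w i)) fun i => by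
      rw [mem_closedBall_zero_iff]
      exact norm_fderiv_le_of_lipschitzOn ℝ (hS.mem_nhds (hw i).2) hf
  have hwz : Tendsto w atTop (𝓝 z) := by
    rw [tendsto_iff_dist_tendsto_zero]
    exact squeeze_zero (fun _ => dist_nonneg) (fun i => (Metric.mem_ball.1 (hw i).1).le)
      tendsto_one_div_add_atTop_nhds_zero_nat
  refine ⟨p, subset_closedConvexHull ⟨w ∘ φ, fun i =>
    ⟨interior_maximal hSΩ hS (hw _).2, hd _⟩, hwz.comp hφ.tendsto_atTop, hp⟩, ?_⟩
  have h1 : Tendsto (fun i => fderiv ℝ f (w (φ i)) v) atTop (𝓝 (p v)) :=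
    ((ContinuousLinearMap.apply ℝ ℝ v).continuous.tendsto p).comp hp
  have h2 : Tendsto (fun i : ℕ => a - 1 / ((φ i : ℝ) + 1)) atTop (𝓝 (a - 0)) :=
    tendsto_const_nhds.sub (tendsto_one_div_add_atTop_nhds_zero_nat.comp hφ.tendsto_atTop)
  rw [sub_zero] at h2
  exact le_of_tendsto_of_tendsto' h2 h1 fun i => (hlt (φ i)).le

end Clarke

/-! ### Lyapunov functions along solutions -/

namespace DiffInclusion

theorem IsLocallyBounded.exists_bound {E : Type*} [NormedAddCommGroup E] {F : E → ℝ → Set E}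
    {t₀ : ℝ} (hF : IsLocallyBounded F t₀) {K : Set (E × ℝ)}
    (hK : IsCompact K) (hKt : ∀ z ∈ K, t₀ ≤ z.2) :
    ∃ M : ℝ, ∀ z ∈ K, ∀ v ∈ F z.1 z.2, ‖v‖ ≤ M := by
  refine hK.induction_on (p := fun S => ∃ M : ℝ, ∀ z ∈ S, ∀ v ∈ F z.1 z.2, ‖v‖ ≤ M)
    ⟨0, by simp⟩ (fun S S' h ⟨M, hM⟩ => ⟨M, fun z hz => hM z (h hz)⟩) ?_ ?_
  · rintro S S' ⟨M, hM⟩ ⟨M', hM'⟩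
    refine ⟨max M M', fun z hz v hv => ?_⟩
    rcases hz with hz | hz
    · exact (hM z hz v hv).trans (le_max_left _ _)
    · exact (hM' z hz v hv).trans (le_max_right _ _)
  · intro z hz
    obtain ⟨N, hN, hb⟩ := hF z.1 z.2 (hKt z hz)
    obtain ⟨M, hM⟩ := hb.exists_norm_le
    refine ⟨N ∩ K, inter_mem (mem_nhdsWithin_of_mem_nhds hN) self_mem_nhdsWithin, M,
      fun y hy v hv => hM v ?_⟩
    exact mem_biUnion (x := y) ⟨hy.1, mem_univ _, hKt y hy.2⟩ hv

/-! ### Restriction, continuation and decrease along solutions -/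

section Solutions

variable {E : Type*} [NormedAddCommGroup E] [NormedSpace ℝ E] {F : E → ℝ → Set E} {x : ℝ → E}
  {s t₀ : ℝ} {T : EReal}

theorem IsSolution.restrict (hx : IsSolution F x s T) {a : ℝ} (hsa : s ≤ a) (haT : (a : EReal) < T) :
    IsSolution F x a T := by
  have hsub : timeInterval a T ⊆ timeInterval s T := fun t ht => ⟨hsa.trans ht.1, ht.2⟩
  refine ⟨haT, fun b hb => ?_, ae_restrict_of_ae_restrict_of_subset hsub hx.deriv_mem⟩
  refine (hx.absolutelyContinuous b ⟨hsa.trans hb.1, hb.2⟩).mono ?_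
  rw [uIcc_of_le hb.1, uIcc_of_le (hsa.trans hb.1)]
  exact Icc_subset_Icc_left hsa

theorem IsSolution.absolutelyContinuousOnInterval (hx : IsSolution F x s T) {a b : ℝ} (hsa : s ≤ a)
    (hab : a ≤ b) (hbT : (b : EReal) < T) : AbsolutelyContinuousOnInterval x a b :=
  (hx.restrict hsa ((EReal.coe_le_coe_iff.2 hab).trans_lt hbT)).absolutelyContinuous b ⟨hab, hbT⟩

theorem IsSolution.ae_hasDerivAt (hx : IsSolution F x s T) {a b : ℝ} (hsa : s ≤ a)
    (hbT : (b : EReal) ≤ T) : ∀ᵐ t, t ∈ Ioo a b → ∃ v ∈ F (x t) t, HasDerivAt x v t := by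
  have hsub : Ioo a b ⊆ timeInterval s T := fun t ht =>
    ⟨hsa.trans ht.1.le, (EReal.coe_lt_coe_iff.2 ht.2).trans_le hbT⟩
  rw [← ae_restrict_iff' measurableSet_Ioo]
  exact ae_restrict_of_ae_restrict_of_subset hsub hx.deriv_mem

theorem IsSolution.isMaximalSolution (hx : IsSolution F x s ⊤) : IsMaximalSolution F x s ⊤ :=
  ⟨hx, fun ⟨_, _, h, _⟩ => not_top_lt h⟩

/-- A solution over a bounded interval that extends continuously to the right end can be followed by
another solution. -/
theorem IsSolution.concat {τ : ℝ} {T' : EReal} {z w : ℝ → E} (hx : IsSolution F x s τ)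
    (hz : IsSolution F z τ T') (hw : AbsolutelyContinuousOnInterval w s τ)
    (hxw : ∀ t ∈ Ico s τ, x t = w t) (hwz : w τ = z τ) :
    IsSolution F (fun t => if t < τ then x t else z t) s T' := by
  have hsτ : s < τ := EReal.coe_lt_coe_iff.1 hx.lt
  have hyw : ∀ t ∈ Icc s τ, (if t < τ then x t else z t) = w t := by
    intro t ht
    split_ifs with h
    · exact hxw t ⟨ht.1, h⟩
    · rw [le_antisymm ht.2 (not_lt.1 h), hwz]
  have hyz : ∀ t, τ ≤ t → (if t < τ then x t else z t) = z t := fun t ht => if_neg ht.not_gt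
  refine ⟨hx.lt.trans hz.lt, fun b hb => ?_, ?_⟩
  · rcases le_total b τ with h | h
    · refine (hw.concat hsτ.le le_rfl (hz.absolutelyContinuous τ ⟨le_rfl, hz.lt⟩) hyw
        fun t ht => hyz t ht.1).mono ?_
      rw [uIcc_of_le hb.1, uIcc_of_le hsτ.le]
      exact Icc_subset_Icc_right h
    · exact hw.concat hsτ.le h (hz.absolutelyContinuous b ⟨h, hb.2⟩) hyw fun t ht => hyz t ht.1
  · have hsub : timeInterval s T' ⊆ timeInterval s τ ∪ timeInterval τ T' := by
      intro t ht
      rcases lt_or_ge t τ with h | h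
      · exact Or.inl ⟨ht.1, EReal.coe_lt_coe_iff.2 h⟩
      · exact Or.inr ⟨h, ht.2⟩
    refine ae_restrict_of_ae_restrict_of_subset hsub ?_
    -- The concatenation may have a corner at the junction, a null set.
    have hτ : ∀ᵐ t : ℝ, t ≠ τ := Measure.ae_ne volume τ
    have meas : ∀ (a : ℝ) (B : EReal), MeasurableSet (timeInterval a B) := fun a B =>
      measurableSet_Ici.inter (measurableSet_lt measurable_coe_real_ereal measurable_const)
    rw [ae_restrict_union_iff]
    constructor
    · filter_upwards [hx.deriv_mem, ae_restrict_mem (meas s τ)] with t ⟨v, hv, hd⟩ ht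
      have h : t < τ := EReal.coe_lt_coe_iff.1 ht.2
      refine ⟨v, by simpa [h] using hv, hd.congr_of_eventuallyEq ?_⟩
      filter_upwards [gt_mem_nhds h] with u hu using if_pos hu
    · filter_upwards [hz.deriv_mem, ae_restrict_mem (meas τ T'), ae_restrict_of_ae hτ]
        with t ⟨v, hv, hd⟩ ht hne
      have h : τ < t := lt_of_le_of_ne ht.1 hne.symm
      refine ⟨v, by simpa [h.not_gt] using hv, hd.congr_of_eventuallyEq ?_⟩
      filter_upwards [lt_mem_nhds h] with u hu using hyz u (le_of_lt hu)

/-- A maximal solution confined to a compact set from which solutions can be continued is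
complete. -/
theorem IsMaximalSolution.eq_top_of_forall_mem [FiniteDimensional ℝ E] {D K : Set E}
    (hFb : IsLocallyBounded F t₀)
    (hFs : AdmitsSolutions F D (Ici t₀)) (hs : t₀ ≤ s) (hx : IsMaximalSolution F x s T)
    (hK : IsCompact K) (hKD : K ⊆ D) (hxK : ∀ t ∈ timeInterval s T, x t ∈ K) : T = ⊤ := by
  by_contra hT
  have hbot : T ≠ ⊥ := (bot_le.trans_lt hx.1.lt).ne'
  lift T to ℝ using ⟨hT, hbot⟩
  have hsT : s < T := EReal.coe_lt_coe_iff.1 hx.1.lt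
  -- The end time is included to make the product compact, hence the speed bounded.
  obtain ⟨M, hM⟩ := hFb.exists_bound (hK.prod (isCompact_Icc (a := s) (b := T)))
    fun z hz => hs.trans hz.2.1
  have hbound : ∀ a ∈ Ico s T, ∀ b ∈ Ico s T, a ≤ b → ‖x b - x a‖ ≤ M * (b - a) := by
    intro a ha b hb hab
    refine (hx.1.absolutelyContinuousOnInterval ha.1 hab
      (EReal.coe_lt_coe_iff.2 hb.2)).norm_sub_le_of_ae_norm_deriv_le hab ?_
    filter_upwards [hx.1.ae_hasDerivAt ha.1 (EReal.coe_lt_coe_iff.2 hb.2).le] with t ht hmem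
    obtain ⟨v, hv, hd⟩ := ht hmem
    have h1 : s ≤ t := ha.1.trans hmem.1.le
    have h2 : t < T := hmem.2.trans hb.2
    exact ⟨v, hM (x t, t) ⟨hxK t ⟨h1, EReal.coe_lt_coe_iff.2 h2⟩, h1, h2.le⟩ v hv, hd⟩
  have hlip : LipschitzOnWith M.toNNReal x (Ico s T) := by
    refine LipschitzOnWith.of_dist_le_mul fun a ha b hb => ?_
    rw [dist_eq_norm, Real.dist_eq]
    have hMM : M ≤ (M.toNNReal : ℝ) := Real.le_coe_toNNReal M
    rcases le_total a b with h | h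
    · rw [norm_sub_rev, abs_sub_comm, abs_of_nonneg (sub_nonneg.2 h)]
      exact (hbound a ha b hb h).trans (mul_le_mul_of_nonneg_right hMM (sub_nonneg.2 h))
    · rw [abs_of_nonneg (sub_nonneg.2 h)]
      exact (hbound b hb a ha h).trans (mul_le_mul_of_nonneg_right hMM (sub_nonneg.2 h))
  -- The Lipschitz extension supplies the missing end value `w T`, from which a further solution
  -- contradicts maximality.
  obtain ⟨w, hw, hxw⟩ := hlip.extend_finite_dimension
  have hwT : w T ∈ K := by
    have h1 : Tendsto w (𝓝[<] T) (𝓝 (w T)) :=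
      (hw.continuous.tendsto T).mono_left nhdsWithin_le_nhds
    refine hK.isClosed.mem_of_tendsto h1 ?_
    filter_upwards [Ico_mem_nhdsLT hsT] with t ht
    rw [← hxw ht]
    exact hxK t ⟨ht.1, EReal.coe_lt_coe_iff.2 ht.2⟩
  obtain ⟨T', z, hz, hzT⟩ := hFs (w T) (hKD hwT) T (hs.trans hsT.le)
  refine hx.2 ⟨T', _, hz.lt, hx.1.concat hz hw.lipschitzOnWith.absolutelyContinuousOnInterval hxw
    hzT.symm, fun t ht => ?_⟩
  exact (if_pos (EReal.coe_lt_coe_iff.1 ht.2)).symm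

/-- Along every solution, over the time intervals on which the solution stays in `D`, the function
`V` decreases at a rate that is bounded below by every lower bound of `W`. -/
def DecreasesAlongSolutions (F : E → ℝ → Set E) (t₀ : ℝ) (D : Set E) (V : E × ℝ → ℝ) (W : E → ℝ) :
    Prop :=
  ∀ (s : ℝ) (T : EReal) (x : ℝ → E), t₀ ≤ s → IsSolution F x s T →
    ∀ a b γ : ℝ, s ≤ a → a ≤ b → (b : EReal) < T → (∀ t ∈ Icc a b, x t ∈ D) →
      (∀ t ∈ Icc a b, γ ≤ W (x t)) → V (x b, b) ≤ V (x a, a) - γ * (b - a)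

/-- Regularity of the `U i` makes the actual velocity admissible in the reduced inclusion, so the
inner supremum sees it. If `V` is regular, every `p` takes the value `a` on `(q, 1)` and the infimum
does no harm; otherwise one `p` with value at least `a` suffices. -/
theorem le_generalizedDeriv [FiniteDimensional ℝ E] {D : Set E} (hD : IsOpen D) {U : ℕ → E × ℝ → ℝ}
    (hUlip : ∀ i, LocallyLipschitzOn (D ×ˢ Ici t₀) (U i))
    (hUreg : ∀ i, ClarkeRegularOn (D ×ˢ Ici t₀) (U i)) {V : E × ℝ → ℝ}
    (hVlip : LocallyLipschitzOn (D ×ˢ Ici t₀) V) {t a : ℝ} {q : E} (ht : t₀ < t) (hxD : x t ∈ D)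
    (hq : HasDerivAt x q t) (hqF : q ∈ F (x t) t)
    (hU : ∀ i, DifferentiableAt ℝ (fun τ => U i (x τ, τ)) t)
    (hV : HasDerivAt (fun τ => V (x τ, τ)) a t) :
    (a : EReal) ≤ generalizedDeriv (D ×ˢ Ici t₀) U F V (x t) t := by
  have hz : (x t, t) ∈ interior (D ×ˢ Ici t₀) := by
    rw [interior_prod_eq, hD.interior_eq, interior_Ici]
    exact ⟨hxD, ht⟩
  have hc : HasDerivAt (fun τ => (x τ, τ)) (q, 1) t := hq.prodMk (hasDerivAt_id t)
  have along : ∀ {f : E × ℝ → ℝ} {b : ℝ}, LocallyLipschitzOn (D ×ˢ Ici t₀) f →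
      HasDerivAt (fun τ => f (x τ, τ)) b t →
      HasDerivAt (fun h : ℝ => f ((x t, t) + h • (q, (1 : ℝ)))) b 0 := by
    intro f b hf hb
    obtain ⟨K, S, hSo, hzS, -, hK⟩ := hf.exists_isOpen_lipschitzOnWith hz
    exact hK.hasDerivAt_along_tangent (c := fun τ => (x τ, τ)) (hSo.mem_nhds hzS) hc hb
  have const : ∀ {f : E × ℝ → ℝ} {b : ℝ}, LocallyLipschitzOn (D ×ˢ Ici t₀) f →
      ClarkeRegularOn (D ×ˢ Ici t₀) f → HasDerivAt (fun τ => f (x τ, τ)) b t →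
      ∀ p ∈ clarkeGradient (D ×ˢ Ici t₀) f (x t, t), p (q, 1) = b := by
    intro f b hf hreg hb p hp
    obtain ⟨K, S, hSo, hzS, -, hK⟩ := hf.exists_isOpen_lipschitzOnWith hz
    exact (hreg _ hz).apply_eq_of_mem_clarkeGradient hK (hSo.mem_nhds hzS) (along hf hb) hp
  have hqred : q ∈ reducedInclusion (D ×ˢ Ici t₀) U F (x t) t :=
    mem_iInter.2 fun i => ⟨hqF, _, const (hUlip i) (hUreg i) (hU i).hasDerivAt⟩
  unfold generalizedDeriv
  split_ifs with hreg
  · refine le_iInf₂ fun p hp => ?_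
    rw [← const hVlip hreg hV p hp]
    exact le_iSup₂ (f := fun q' (_ : q' ∈ reducedInclusion (D ×ˢ Ici t₀) U F (x t) t) =>
      ((p (q', 1) : ℝ) : EReal)) q hqred
  · obtain ⟨K, S, hSo, hzS, hSΩ, hK⟩ := hVlip.exists_isOpen_lipschitzOnWith hz
    obtain ⟨p, hp, hap⟩ := exists_mem_clarkeGradient_le_apply hK hSo hzS hSΩ (along hVlip hV)
    refine (EReal.coe_le_coe_iff.2 hap).trans ?_
    refine le_trans ?_ (le_iSup₂ (f := fun p' (_ : p' ∈ clarkeGradient (D ×ˢ Ici t₀) V (x t, t)) =>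
      ⨆ q' ∈ reducedInclusion (D ×ˢ Ici t₀) U F (x t) t, ((p' (q', 1) : ℝ) : EReal)) p hp)
    exact le_iSup₂ (f := fun q' (_ : q' ∈ reducedInclusion (D ×ˢ Ici t₀) U F (x t) t) =>
      ((p (q', 1) : ℝ) : EReal)) q hqred

theorem decreasesAlongSolutions_of_generalizedDeriv_le [FiniteDimensional ℝ E] {D : Set E}
    (hD : IsOpen D) {U : ℕ → E × ℝ → ℝ}
    (hUlip : ∀ i, LocallyLipschitzOn (D ×ˢ Ici t₀) (U i))
    (hUreg : ∀ i, ClarkeRegularOn (D ×ˢ Ici t₀) (U i)) {V : E × ℝ → ℝ}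
    (hVlip : LocallyLipschitzOn (D ×ˢ Ici t₀) V) {W : E → ℝ}
    (hVdot : ∀ᵐ t ∂volume.restrict (Ici t₀), ∀ y ∈ D,
      generalizedDeriv (D ×ˢ Ici t₀) U F V y t ≤ ((-W y : ℝ) : EReal)) :
    DecreasesAlongSolutions F t₀ D V W := by
  intro s T x hs hx a b γ hsa hab hbT hxD hγ
  have hac := (hx.absolutelyContinuousOnInterval hsa hab hbT).prodMk_id
  have hmaps : MapsTo (fun t => (x t, t)) (uIcc a b) (D ×ˢ Ici t₀) := by
    rw [uIcc_of_le hab]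
    exact fun t ht => ⟨hxD t ht, hs.trans (hsa.trans ht.1)⟩
  have comp : ∀ {f : E × ℝ → ℝ}, LocallyLipschitzOn (D ×ˢ Ici t₀) f →
      AbsolutelyContinuousOnInterval (fun t => f (x t, t)) a b := by
    intro f hf
    obtain ⟨K, hK⟩ := (hf.mono hmaps.image_subset).exists_lipschitzOnWith_of_compact
      (isCompact_uIcc.image_of_continuousOn hac.continuousOn)
    exact hK.comp_absolutelyContinuousOnInterval hac (mapsTo_image _ _)
  have hVac := comp hVlip
  -- Countability of the family leaves a single null set of bad times.
  have hU := ae_all_iff.2 fun i => (comp (hUlip i)).ae_differentiableAt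
  have key := hVac.sub_le_of_ae_deriv_le hab (c := -γ) (by
    rw [ae_restrict_iff' measurableSet_Ici] at hVdot
    filter_upwards [hVac.ae_differentiableAt, hU, hx.ae_hasDerivAt hsa hbT.le, hVdot]
      with t h1 h2 h3 h4 hmem
    have hIcc : t ∈ Icc a b := Ioo_subset_Icc_self hmem
    have hu : t ∈ uIcc a b := by rwa [uIcc_of_le hab]
    have ht : t₀ < t := hs.trans_lt (hsa.trans_lt hmem.1)
    obtain ⟨q, hqF, hq⟩ := h3 hmem
    have := (le_generalizedDeriv hD hUlip hUreg hVlip ht (hxD t hIcc) hq hqF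
      (fun i => h2 i hu) (h1 hu).hasDerivAt).trans (h4 ht.le (x t) (hxD t hIcc))
    exact (EReal.coe_le_coe_iff.1 this).trans (neg_le_neg (hγ t hIcc)))
  linarith

end Solutions

/-! ### Lyapunov's stability arguments -/

section Stability

variable {E : Type*} [NormedAddCommGroup E] {F : E → ℝ → Set E} {t₀ : ℝ}
  {D : Set E} {V : E × ℝ → ℝ} {Wlow Wup W : E → ℝ}

theorem PositiveDefiniteOn.nonneg (hW : PositiveDefiniteOn D W) {y : E} (hy : y ∈ D) : 0 ≤ W y := by
  rcases eq_or_ne y 0 with rfl | h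
  · exact hW.1.ge
  · exact (hW.2 y hy h).le

theorem PositiveDefiniteOn.exists_pos_le (hW : PositiveDefiniteOn D W) (hc : ContinuousOn W D)
    {K : Set E} (hK : IsCompact K) (hKD : K ⊆ D) (h0 : (0 : E) ∉ K) :
    ∃ γ : ℝ, 0 < γ ∧ ∀ y ∈ K, γ ≤ W y := by
  rcases K.eq_empty_or_nonempty with rfl | hne
  -- This covers spheres in the zero space and annuli whose inner radius exceeds the outer one.
  · exact ⟨1, one_pos, by simp⟩
  · obtain ⟨y, hy, hmin⟩ := hK.exists_isMinOn hne (hc.mono hKD)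
    exact ⟨W y, hW.2 y (hKD hy) (by rintro rfl; exact h0 hy), fun z hz => hmin hz⟩

theorem PositiveDefiniteOn.exists_closedBall_lt (hW : PositiveDefiniteOn D W)
    (hc : ContinuousOn W D) (hD : IsOpen D) (h0 : (0 : E) ∈ D) {r α : ℝ} (hr : 0 < r) (hα : 0 < α) :
    ∃ δ : ℝ, 0 < δ ∧ δ < r ∧ ∀ y ∈ Metric.closedBall (0 : E) δ, W y < α := by
  have hcont := hc.continuousAt (hD.mem_nhds h0)
  have hev : ∀ᶠ y in 𝓝 (0 : E), W y < α := hcont.eventually (gt_mem_nhds (by rwa [hW.1]))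
  obtain ⟨δ, hδ, hball⟩ := Metric.nhds_basis_closedBall.eventually_iff.1 hev
  exact ⟨min δ (r / 2), by positivity, (min_le_right _ _).trans_lt (half_lt_self hr),
    fun y hy => hball (Metric.closedBall_subset_closedBall (min_le_left _ _) hy)⟩

theorem exists_closedBall_subset (hD : IsOpen D) (h0 : (0 : E) ∈ D) :
    ∃ r : ℝ, 0 < r ∧ Metric.closedBall (0 : E) r ⊆ D :=
  Metric.nhds_basis_closedBall.mem_iff.1 (hD.mem_nhds h0)

variable [NormedSpace ℝ E] [FiniteDimensional ℝ E]

/-- On the sphere of radius `r`, `V ≥ α`, while `V < α` on the ball of radius `δ`. Since `V` does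
not increase, the sphere is never reached; `α` and `δ` do not depend on time. -/
theorem uniformlyStable_of_decreasesAlongSolutions (hD : IsOpen D) (h0 : (0 : E) ∈ D)
    (hFb : IsLocallyBounded F t₀) (hFs : AdmitsSolutions F D (Ici t₀))
    (hlc : ContinuousOn Wlow D) (hlpd : PositiveDefiniteOn D Wlow)
    (huc : ContinuousOn Wup D) (hupd : PositiveDefiniteOn D Wup)
    (hV : ∀ y ∈ D, ∀ t ∈ Ici t₀, Wlow y ≤ V (y, t) ∧ V (y, t) ≤ Wup y)
    (hdec : DecreasesAlongSolutions F t₀ D V 0) : UniformlyStable F t₀ := by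
  have : ProperSpace E := FiniteDimensional.proper ℝ E
  intro ε hε
  obtain ⟨r₀, hr₀, hr₀D⟩ := exists_closedBall_subset hD h0
  set r := min r₀ ε
  have hr : 0 < r := lt_min hr₀ hε
  have hrD : Metric.closedBall (0 : E) r ⊆ D :=
    (Metric.closedBall_subset_closedBall (min_le_left _ _)).trans hr₀D
  obtain ⟨α, hα, hsph⟩ := hlpd.exists_pos_le hlc (isCompact_sphere (0 : E) r)
    (Metric.sphere_subset_closedBall.trans hrD) (by simpa using hr.ne)
  obtain ⟨δ, hδ, hδr, hlt⟩ := hupd.exists_closedBall_lt huc hD h0 hr hα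
  refine ⟨δ, hδ, fun s T x hs hx hxs => ?_⟩
  have stay : ∀ t ∈ timeInterval s T, x t ∈ Metric.closedBall (0 : E) r := by
    by_contra! hcon
    obtain ⟨t, ht, hout⟩ := hcon
    have hcont : ContinuousOn (fun u => ‖x u‖) (Icc s t) := by
      have := (hx.1.absolutelyContinuous t ht).continuousOn.norm
      rwa [uIcc_of_le ht.1] at this
    have hsδ : ‖x s‖ ≤ δ := mem_closedBall_zero_iff.1 hxs
    have hout' : r < ‖x t‖ := by simpa using hout
    have hne : (Icc s t ∩ (fun u => ‖x u‖) ⁻¹' {r}).Nonempty := by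
      obtain ⟨u, hu, hur⟩ := intermediate_value_Icc ht.1 hcont ⟨hsδ.trans hδr.le, hout'.le⟩
      exact ⟨u, hu, hur⟩
    -- The first hitting time is needed because decrease of `V` is known only while the solution
    -- stays in `D`.
    obtain ⟨t₁, ⟨ht₁, hr₁⟩, hleast⟩ := (isCompact_Icc.of_isClosed_subset
      (hcont.preimage_isClosed_of_isClosed isClosed_Icc isClosed_singleton)
      inter_subset_left).exists_isLeast hne
    have hr₁ : ‖x t₁‖ = r := hr₁
    have hin : ∀ u ∈ Icc s t₁, x u ∈ Metric.closedBall (0 : E) r := by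
      intro u hu
      rw [mem_closedBall_zero_iff]
      by_contra! hur
      obtain ⟨u', hu', hur'⟩ := intermediate_value_Icc hu.1
        (hcont.mono (Icc_subset_Icc_right (hu.2.trans ht₁.2))) ⟨hsδ.trans hδr.le, hur.le⟩
      have h1 : t₁ ≤ u' := hleast ⟨⟨hu'.1, hu'.2.trans (hu.2.trans ht₁.2)⟩, hur'⟩
      have h2 : u = t₁ := le_antisymm hu.2 (h1.trans hu'.2)
      rw [h2, hr₁] at hur
      exact lt_irrefl _ hur
    have hdecr := hdec s T x hs hx.1 s t₁ 0 le_rfl ht₁.1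
      ((EReal.coe_le_coe_iff.2 ht₁.2).trans_lt ht.2) (fun u hu => hrD (hin u hu)) fun _ _ => le_rfl
    have h1 := (hV _ (hrD (hin t₁ ⟨ht₁.1, le_rfl⟩)) t₁ (hs.trans ht₁.1)).1
    have h2 := (hV _ (hrD (hin s ⟨le_rfl, ht₁.1⟩)) s hs).2
    have h3 := hsph (x t₁) (mem_sphere_zero_iff_norm.2 hr₁)
    have h4 := hlt (x s) hxs
    linarith
  have hT := hx.eq_top_of_forall_mem hFb hFs hs (isCompact_closedBall (0 : E) r) hrD stay
  refine ⟨hT, fun t ht => Metric.closedBall_subset_closedBall (min_le_right _ _)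
    (stay t ⟨ht, ?_⟩)⟩
  rw [hT]
  exact EReal.coe_lt_top t

/-- The set between radii `δ` and `R` is compact and avoids the origin, so there `V` falls at a rate
`γ > 0`. Being nonnegative, `V` cannot do so for long: the solution enters the `δ`-ball, and
stability keeps it in the `ε`-ball. -/
theorem uniformlyAttracts_of_decreasesAlongSolutions (hst : UniformlyStable F t₀)
    (hlpd : PositiveDefiniteOn D Wlow) (huc : ContinuousOn Wup D)
    (hV : ∀ y ∈ D, ∀ t ∈ Ici t₀, Wlow y ≤ V (y, t) ∧ V (y, t) ≤ Wup y)
    (hWc : ContinuousOn W D) (hWpd : PositiveDefiniteOn D W)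
    (hdec : DecreasesAlongSolutions F t₀ D V W) {c R : ℝ}
    (hcD : Metric.closedBall (0 : E) c ⊆ D) (hRD : Metric.closedBall (0 : E) R ⊆ D)
    (hbd : ∀ (s : ℝ) (T : EReal) (x : ℝ → E), t₀ ≤ s → IsMaximalSolution F x s T →
      x s ∈ Metric.closedBall 0 c → T = ⊤ ∧ ∀ t, s ≤ t → x t ∈ Metric.closedBall 0 R) :
    UniformlyAttracts F t₀ c := by
  have : ProperSpace E := FiniteDimensional.proper ℝ E
  intro ε hε
  obtain ⟨δ, hδ, hstab⟩ := hst ε hε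
  have hK : IsCompact (Metric.closedBall (0 : E) R \ Metric.ball 0 δ) :=
    (isCompact_closedBall _ _).diff Metric.isOpen_ball
  obtain ⟨γ, hγ, hWγ⟩ := hWpd.exists_pos_le hWc hK (sdiff_subset.trans hRD)
    fun h => h.2 (Metric.mem_ball_self hδ)
  obtain ⟨M, hM⟩ := (isCompact_closedBall (0 : E) c).exists_bound_of_continuousOn (huc.mono hcD)
  have hτ : 0 ≤ (|M| + 1) / γ := by positivity
  -- Over this time the fall would be `|M| + 1`, more than the initial value of `V`.
  refine ⟨(|M| + 1) / γ, hτ, fun s T x hs hx hxs => ?_⟩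
  obtain ⟨rfl, hxR⟩ := hbd s T x hs hx hxs
  refine ⟨rfl, fun t ht => ?_⟩
  obtain ⟨t₁, ht₁, hin⟩ : ∃ t₁ ∈ Icc s (s + (|M| + 1) / γ), x t₁ ∈ Metric.ball (0 : E) δ := by
    by_contra! hcon
    have hdecr := hdec s ⊤ x hs hx.1 s (s + (|M| + 1) / γ) γ le_rfl (by linarith)
      (EReal.coe_lt_top _) (fun u hu => hRD (hxR u hu.1))
      fun u hu => hWγ _ ⟨hxR u hu.1, hcon u hu⟩
    have h1 := (hV _ (hRD (hxR _ (le_add_of_nonneg_right hτ))) (s + (|M| + 1) / γ)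
      (hs.trans (le_add_of_nonneg_right hτ))).1
    have h2 := hlpd.nonneg (hRD (hxR _ (le_add_of_nonneg_right hτ)))
    have h3 := (hV _ (hcD hxs) s hs).2
    have h4 := (le_abs_self _).trans (hM _ hxs)
    have h5 : γ * (s + (|M| + 1) / γ - s) = |M| + 1 := by field_simp; ring
    have h6 := le_abs_self M
    linarith
  -- Uniformity of `δ` in the initial time allows a restart at `t₁`; the restricted solution is
  -- maximal because it is complete.
  exact (hstab t₁ ⊤ x (hs.trans ht₁.1) (hx.1.restrict ht₁.1 (EReal.coe_lt_top _)).isMaximalSolution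
    (Metric.ball_subset_closedBall hin)).2 t (ht₁.2.trans ht)

theorem uniformlyAsymptoticallyStable_of_decreasesAlongSolutions (hD : IsOpen D)
    (h0 : (0 : E) ∈ D) (hst : UniformlyStable F t₀)
    (hlpd : PositiveDefiniteOn D Wlow) (huc : ContinuousOn Wup D)
    (hV : ∀ y ∈ D, ∀ t ∈ Ici t₀, Wlow y ≤ V (y, t) ∧ V (y, t) ≤ Wup y)
    (hWc : ContinuousOn W D) (hWpd : PositiveDefiniteOn D W)
    (hdec : DecreasesAlongSolutions F t₀ D V W) : UniformlyAsymptoticallyStable F t₀ := by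
  obtain ⟨r, hr, hrD⟩ := exists_closedBall_subset hD h0
  obtain ⟨δ, hδ, hstab⟩ := hst r hr
  refine ⟨hst, min δ r, lt_min hδ hr, uniformlyAttracts_of_decreasesAlongSolutions hst hlpd huc hV
    hWc hWpd hdec ((Metric.closedBall_subset_closedBall (min_le_right _ _)).trans hrD) hrD
    fun s T x hs hx hxs => hstab s T x hs hx
      (Metric.closedBall_subset_closedBall (min_le_left _ _) hxs)⟩

/-- The trapping region is a compact sublevel set of `Wlow`, available for every `c`, instead of a
small ball. -/
theorem globallyUniformlyAsymptoticallyStable_of_decreasesAlongSolutions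
    (hFb : IsLocallyBounded F t₀) (hFs : AdmitsSolutions F univ (Ici t₀))
    (hst : UniformlyStable F t₀) (hlpd : PositiveDefiniteOn univ Wlow)
    (hcpt : ∀ c : ℝ, 0 ≤ c → IsCompact {y | Wlow y ≤ c})
    (huc : ContinuousOn Wup univ)
    (hV : ∀ y ∈ univ, ∀ t ∈ Ici t₀, Wlow y ≤ V (y, t) ∧ V (y, t) ≤ Wup y)
    (hWc : ContinuousOn W univ) (hWpd : PositiveDefiniteOn univ W)
    (hdec₀ : DecreasesAlongSolutions F t₀ univ V 0)
    (hdec : DecreasesAlongSolutions F t₀ univ V W) :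
    GloballyUniformlyAsymptoticallyStable F t₀ := by
  have : ProperSpace E := FiniteDimensional.proper ℝ E
  refine ⟨hst, fun c _ => ?_⟩
  obtain ⟨M, hM⟩ := (isCompact_closedBall (0 : E) c).exists_bound_of_continuousOn
    (huc.mono (subset_univ _))
  have hK := hcpt |M| (abs_nonneg M)
  obtain ⟨R, hR⟩ := hK.isBounded.subset_closedBall (0 : E)
  refine uniformlyAttracts_of_decreasesAlongSolutions hst hlpd huc hV hWc hWpd hdec
    (subset_univ _) (subset_univ (Metric.closedBall 0 R)) fun s T x hs hx hxs => ?_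
  have stay : ∀ t ∈ timeInterval s T, x t ∈ {y | Wlow y ≤ |M|} := by
    intro t ht
    have h1 := hdec₀ s T x hs hx.1 s t 0 le_rfl ht.1 ht.2 (fun _ _ => mem_univ _) fun _ _ => le_rfl
    have h2 := (hV _ (mem_univ (x t)) t (hs.trans ht.1)).1
    have h3 := (hV _ (mem_univ (x s)) s hs).2
    have h4 := (le_abs_self _).trans (hM _ hxs)
    have h5 := le_abs_self M
    change Wlow (x t) ≤ |M|
    linarith
  have hT := hx.eq_top_of_forall_mem hFb hFs hs hK (subset_univ _) stay
  refine ⟨hT, fun t ht => hR (stay t ⟨ht, ?_⟩)⟩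
  rw [hT]
  exact EReal.coe_lt_top t

end Stability

end DiffInclusion

theorem mainTheorem5 (n : ℕ) (t₀ : ℝ)
    (D : Set (EuclideanSpace ℝ (Fin n))) (hDo : IsOpen D) (hDc : IsConnected D) (hD0 : 0 ∈ D)
    (F : EuclideanSpace ℝ (Fin n) → ℝ → Set (EuclideanSpace ℝ (Fin n)))
    (hFb : IsLocallyBounded F t₀)
    (hFc : ∀ x, ∀ t ∈ Ici t₀, IsCompact (F x t))
    (hFs : AdmitsSolutions F D (Ici t₀))
    (U : ℕ → EuclideanSpace ℝ (Fin n) × ℝ → ℝ)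
    (hUlip : ∀ i, LocallyLipschitzOn (D ×ˢ Ici t₀) (U i))
    (hUreg : ∀ i, ClarkeRegularOn (D ×ˢ Ici t₀) (U i))
    (V : EuclideanSpace ℝ (Fin n) × ℝ → ℝ)
    (hVlip : LocallyLipschitzOn (D ×ˢ Ici t₀) V)
    (hVpd : TimeVaryingPositiveDefiniteOn D t₀ V)
    (Wlow Wup : EuclideanSpace ℝ (Fin n) → ℝ)
    (hWlow_cont : ContinuousOn Wlow D) (hWlow_pd : PositiveDefiniteOn D Wlow)
    (hWup_cont : ContinuousOn Wup D) (hWup_pd : PositiveDefiniteOn D Wup)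
    (hVbounds : ∀ x ∈ D, ∀ t ∈ Ici t₀, Wlow x ≤ V (x, t) ∧ V (x, t) ≤ Wup x)
    (hVdot : ∀ᵐ t ∂volume.restrict (Ici t₀), ∀ x ∈ D,
      generalizedDeriv (D ×ˢ Ici t₀) U F V x t ≤ 0) :
    UniformlyStable F t₀ ∧
    ∀ W : EuclideanSpace ℝ (Fin n) → ℝ, ContinuousOn W D → PositiveDefiniteOn D W →
      (∀ᵐ t ∂volume.restrict (Ici t₀), ∀ x ∈ D,
        generalizedDeriv (D ×ˢ Ici t₀) U F V x t ≤ ((-W x : ℝ) : EReal)) →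
      UniformlyAsymptoticallyStable F t₀ ∧
      (D = univ → (∀ c : ℝ, 0 ≤ c → IsCompact {x | Wlow x ≤ c}) →
        GloballyUniformlyAsymptoticallyStable F t₀) := by
  have hdec₀ : DecreasesAlongSolutions F t₀ D V 0 :=
    decreasesAlongSolutions_of_generalizedDeriv_le hDo hUlip hUreg hVlip (by simpa using hVdot)
  have hst := uniformlyStable_of_decreasesAlongSolutions hDo hD0 hFb hFs hWlow_cont hWlow_pd
    hWup_cont hWup_pd hVbounds hdec₀
  refine ⟨hst, fun W hWc hWpd hWdot => ?_⟩
  have hdec := decreasesAlongSolutions_of_generalizedDeriv_le hDo hUlip hUreg hVlip hWdot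
  refine ⟨uniformlyAsymptoticallyStable_of_decreasesAlongSolutions hDo hD0 hst hWlow_pd hWup_cont
    hVbounds hWc hWpd hdec, fun hD hcpt => ?_⟩
  subst hD
  exact globallyUniformlyAsymptoticallyStable_of_decreasesAlongSolutions hFb hFs hst hWlow_pd hcpt
    hWup_cont hVbounds hWc hWpd hdec₀ hdec
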